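/- Let $N\ge 1$ be a real number, and for real $k\ge 0$ put $v_k=\pi^{k/2}/\Gamma(k/2+1)$. On a metric space let $\mathcal H^k$ denote the $k$-dimensional Hausdorff measure with the normalization $\mathcal H^k(A)=\lim_{\delta\to0}\frac{v_k}{2^k}\inf\{\sum_i \operatorname{diam}(A_i)^k : A\subset\bigcup_i A_i,\ \operatorname{diam}(A_i)<\delta\}$ over countable covers (so $\mathcal H^0$ is the counting measure). Let $X$ be a compact metric space with $\mathcal H^N(X)<\infty$, let $p,q\in(1,\infty)$ satisfy $p^{-1}+q^{-1}=1$, and let $E,F\subset X$ be disjoint continua, i.e. nonempty compact connected sets. Let $\Gamma(E,F)$ be the family of all continuous curves $\gamma:[a,b]\to X$ that have one endpoint in $E$ and the other in $F$. Let $\Sigma_H(E,F)$ be the family of all measures of the form $\mathcal H^{N-1}|_{\partial U}$ that are finite, where $U\subset X$ is open with $E\subset U$ and $F\subset\operatorname{int}(X\setminus U)$. Define $$\operatorname{Mod}_p\Gamma(E,F)=\inf_\rho\int_X\rho^p\,d\mathcal H^N,\qquad \operatorname{Mod}_q\Sigma_H(E,F)=\inf_\rho\int_X\rho^q\,d\mathcal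 H^N,$$ where the infima are over Borel functions $\rho:X\to[0,\infty]$ such that, in the first case, $\int_\gamma\rho\,ds\ge1$ (integral with respect to arc length) for every rectifiable $\gamma\in\Gamma(E,F)$ and, in the second case, $\int\rho\,d\sigma\ge1$ for every $\sigma\in\Sigma_H(E,F)$; here $\inf\emptyset=\infty$. If $\operatorname{Mod}_p\Gamma(E,F)>0$, then $$(\operatorname{Mod}_p\Gamma(E,F))^{1/p}\,(\operatorname{Mod}_q\Sigma_H(E,F))^{1/q}\ \ge\ \frac{v_N}{2v_{N-1}}$$ (where the left-hand side may be $\infty$). If $\operatorname{Mod}_p\Gamma(E,F)=0$, then $\operatorname{Mod}_q\Sigma_H(E,F)=\infty$. -/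

import Mathlib

open scoped ENNReal MeasureTheory

namespace MetricModulus

/-- The constant `v_k = π^(k/2) / Γ(k/2 + 1)`, for a real number `k ≥ 0`. For a positive integer
`k` it is the volume of the unit ball of `ℝ^k`; moreover `v_0 = 1`. -/
noncomputable def ballVol (k : ℝ) : ℝ :=
  Real.pi ^ (k / 2) / Real.Gamma (k / 2 + 1)

/-- The `s`-dimensional Hausdorff measure, normalized by the factor `v_s / 2^s`. Mathlib's `μH[s]`
is the Hausdorff measure built from the sums of `diam(A_i)^s`, without a factor. For `s = 0` this
is the counting measure. -/
noncomputable def hausdorff {X : Type*} [MetricSpace X] [MeasurableSpace X] [BorelSpace X]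
    (s : ℝ) : MeasureTheory.Measure X :=
  ENNReal.ofReal (ballVol s / 2 ^ s) • μH[s]

/-- A curve in `X`: a continuous map from a compact nonempty interval `[a, b]` to `X`. Only the
values of `toFun` on `[a, b]` matter. -/
structure Curve (X : Type*) [MetricSpace X] where
  a : ℝ
  b : ℝ
  le : a ≤ b
  toFun : ℝ → X
  cont : ContinuousOn toFun (Set.Icc a b)

namespace Curve

variable {X : Type*} [MetricSpace X]

/-- The length of a curve: the supremum of the sums of `d(γ(t_i), γ(t_{i+1}))` over the finite
partitions of `[a, b]`. -/
noncomputable def length (γ : Curve X) : ℝ≥0∞ :=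
  eVariationOn γ.toFun (Set.Icc γ.a γ.b)

/-- A curve is rectifiable if its length is finite. -/
def Rectifiable (γ : Curve X) : Prop :=
  γ.length < ∞

/-- The arc-length parametrization of a rectifiable curve `γ`, on the interval `[0, length γ]`:
its value at the length of `γ|[a, t]` is `γ t`. -/
noncomputable def arcLength (γ : Curve X) : ℝ → X :=
  naturalParameterization γ.toFun (Set.Icc γ.a γ.b) γ.a

/-- The line integral `∫_γ ρ ds` of a Borel function `ρ : X → [0, ∞]` over a rectifiable curve. -/
noncomputable def lineIntegral (γ : Curve X) (ρ : X → ℝ≥0∞) : ℝ≥0∞ :=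
  ∫⁻ s in Set.Icc 0 γ.length.toReal, ρ (γ.arcLength s)

/-- The curve `γ` connects `E` and `F`: one of its endpoints is in `E` and the other in `F`. -/
def Connects (γ : Curve X) (E F : Set X) : Prop :=
  (γ.toFun γ.a ∈ E ∧ γ.toFun γ.b ∈ F) ∨ (γ.toFun γ.a ∈ F ∧ γ.toFun γ.b ∈ E)

end Curve

/-- The family `Γ(E, F)` of the curves in `X` that connect `E` and `F`. -/
def connectingCurves {X : Type*} [MetricSpace X] (E F : Set X) : Set (Curve X) :=
  {γ | γ.Connects E F}

/-- The family `Σ_H(E, F)` of the finite measures of the form `ℋ^{N-1}|_{∂U}`, where `U` is an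
open set with `E ⊆ U` and `F ⊆ int(Uᶜ)`. -/
def separatingMeasures {X : Type*} [MetricSpace X] [MeasurableSpace X] [BorelSpace X]
    (N : ℝ) (E F : Set X) : Set (MeasureTheory.Measure X) :=
  {σ | ∃ U : Set X, IsOpen U ∧ E ⊆ U ∧ F ⊆ interior Uᶜ ∧
    σ = (hausdorff (N - 1)).restrict (frontier U) ∧ MeasureTheory.IsFiniteMeasure σ}

/-- Admissible functions of a curve family: Borel functions `ρ : X → [0, ∞]` with
`∫_γ ρ ds ≥ 1` for every rectifiable `γ` in the family. -/
def AdmCurves {X : Type*} [MetricSpace X] [MeasurableSpace X] [BorelSpace X]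
    (Γ : Set (Curve X)) : Set (X → ℝ≥0∞) :=
  {ρ | Measurable ρ ∧ ∀ γ ∈ Γ, γ.Rectifiable → 1 ≤ γ.lineIntegral ρ}

/-- Admissible functions of a family of measures: Borel functions `ρ : X → [0, ∞]` with
`∫ ρ dσ ≥ 1` for every `σ` in the family. -/
def AdmMeasures {X : Type*} [MeasurableSpace X]
    (S : Set (MeasureTheory.Measure X)) : Set (X → ℝ≥0∞) :=
  {ρ | Measurable ρ ∧ ∀ σ ∈ S, 1 ≤ ∫⁻ x, ρ x ∂σ}

/-- The `p`-modulus of a curve family, with respect to `ℋ^N`; it is `∞` if no function is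
admissible. -/
noncomputable def modCurves {X : Type*} [MetricSpace X] [MeasurableSpace X] [BorelSpace X]
    (N p : ℝ) (Γ : Set (Curve X)) : ℝ≥0∞ :=
  ⨅ ρ ∈ AdmCurves Γ, ∫⁻ x, ρ x ^ p ∂(hausdorff N)

/-- The `p`-modulus of a family of measures, with respect to `ℋ^N`; it is `∞` if no function is
admissible. -/
noncomputable def modMeasures {X : Type*} [MetricSpace X] [MeasurableSpace X] [BorelSpace X]
    (N p : ℝ) (S : Set (MeasureTheory.Measure X)) : ℝ≥0∞ :=
  ⨅ ρ ∈ AdmMeasures S, ∫⁻ x, ρ x ^ p ∂(hausdorff N)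

end MetricModulus

/-! The heart is `one_le_lintegral_mul_of_lowerSemicontinuous`: if `ρ` is admissible for the curves
and `g` for the separating measures, then `∫ g ρ dℋ^N ≥ v_N / (2 v_{N-1})`. Hölder's inequality and
infima over `ρ` and `g` give both claims.

By Vitali–Carathéodory, `ρ` may be taken lower semicontinuous and bounded below by a positive
constant. Let `u` be the distance from `E` weighted by `min ρ (n + 1)`, measured along chains with
steps at most `1 / (n + 1)` and truncated at 1. Chains make `u` continuous even if `X` has few
rectifiable curves. For `a < 1` and a suitable `n`, `u ≥ a` on `F`: otherwise cheap chains, of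
bounded length because `ρ` is bounded below, would converge to a curve with `∫ ρ ds ≤ a`
(`exists_curve_of_chains`).

For `0 < t < a` the set `{u < t}` separates `E` from `F`, and its frontier lies in `{u = t}`. The
coarea inequality `exists_measurable_lintegral_fiber_le` bounds the integral over `t` of `∫_{u = t}
g` by `∫ g ρ`. For unnormalized Hausdorff measures its constant is 1, so the final constant is just
the ratio of the two normalizations. -/

/-! ### Coarea inequality for functions with a pointwise Lipschitz bound at small scales. -/

open MeasureTheory Set Filter Topology in
/-- Eilenberg's inequality for the level sets of a function that is Lipschitz on a small scale. -/
theorem exists_measurable_hausdorffMeasure_fiber_le {X : Type*} [MetricSpace X]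
    [MeasurableSpace X] [BorelSpace X] {k : ℝ} (hk : 0 ≤ k) (u : X → ℝ) (A : Set X)
    {b δ : ℝ≥0∞} (hb : b ≠ 0) (hb' : b ≠ ∞) (hδ : 0 < δ)
    (hu : ∀ x ∈ A, ∀ y ∈ A, edist x y < δ → edist (u x) (u y) ≤ b * edist x y) :
    ∃ ψ : ℝ → ℝ≥0∞, Measurable ψ ∧ (∀ t, μH[k] (A ∩ u ⁻¹' {t}) ≤ ψ t) ∧
      ∫⁻ t, ψ t ≤ b * μH[k + 1] A := by
  by_cases hA : μH[k + 1] A = ∞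
  · exact ⟨fun _ ↦ ∞, measurable_const, fun _ ↦ le_top, by simp [hA, hb]⟩
  obtain ⟨δ', hδ'0, hδ'⟩ := exists_between hδ
  -- The cap `δ' < δ` brings any two points of a covering set within the range of `hu`.
  set r : ℕ → ℝ≥0∞ := fun j ↦ min δ' ((j : ℝ≥0∞) + 1)⁻¹ with hr
  have hr0 : ∀ j, 0 < r j := fun j ↦ lt_min hδ'0 (ENNReal.inv_pos.2 (by finiteness))
  have hinv : Tendsto (fun j : ℕ ↦ ((j : ℝ≥0∞) + 1)⁻¹) atTop (𝓝 0) := by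
    have := (tendsto_add_atTop_iff_nat 1).2 ENNReal.tendsto_inv_nat_nhds_zero
    simpa using this
  have hrlim : Tendsto r atTop (𝓝 0) :=
    tendsto_of_tendsto_of_tendsto_of_le_of_le tendsto_const_nhds hinv (fun _ ↦ zero_le)
      (fun _ ↦ min_le_right _ _)
  have hcov : ∀ j : ℕ, ∃ T : ℕ → Set X, A ⊆ ⋃ i, T i ∧ (∀ i, Metric.ediam (T i) ≤ r j) ∧
      ∑' i, ⨆ _ : (T i).Nonempty, Metric.ediam (T i) ^ (k + 1) ≤
        μH[k + 1] A + ((j : ℝ≥0∞) + 1)⁻¹ := by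
    intro j
    have h1 : (⨅ (t : ℕ → Set X) (_ : A ⊆ ⋃ n, t n) (_ : ∀ n, Metric.ediam (t n) ≤ r j),
          ∑' n, ⨆ _ : (t n).Nonempty, Metric.ediam (t n) ^ (k + 1)) <
          μH[k + 1] A + ((j : ℝ≥0∞) + 1)⁻¹ := by
      refine lt_of_le_of_lt ?_ (ENNReal.lt_add_right hA
        (ENNReal.inv_ne_zero.2 (by finiteness) : ((j : ℝ≥0∞) + 1)⁻¹ ≠ 0))
      rw [Measure.hausdorffMeasure_apply]
      exact le_iSup₂_of_le (r j) (hr0 j) le_rfl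
    simp only [iInf_lt_iff] at h1
    obtain ⟨T, hT1, hT2, hT3⟩ := h1
    exact ⟨T, hT1, hT2, hT3.le⟩
  choose T hT1 hT2 hT3 using hcov
  -- The images need not be measurable; measurable hulls of equal measure keep `Ψ j` measurable. `Ψ
  -- j t` bounds the `k`-dimensional cost of the pieces that meet the fiber over `t`.
  set I : ℕ → ℕ → Set ℝ := fun j i ↦ toMeasurable volume (u '' (T j i ∩ A)) with hI
  set Ψ : ℕ → ℝ → ℝ≥0∞ := fun j t ↦
    ∑' i, (I j i).indicator (fun _ ↦ Metric.ediam (T j i) ^ k) t with hΨ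
  have hΨm : ∀ j, Measurable (Ψ j) := fun j ↦
    Measurable.tsum fun i ↦ measurable_const.indicator (measurableSet_toMeasurable _ _)
  have hΨi : ∀ j, ∫⁻ t, Ψ j t ≤ b * (μH[k + 1] A + ((j : ℝ≥0∞) + 1)⁻¹) := by
    intro j
    rw [lintegral_tsum fun i ↦
      (measurable_const.indicator (measurableSet_toMeasurable _ _)).aemeasurable]
    refine le_trans ?_ (mul_le_mul_right (hT3 j) b)
    rw [← ENNReal.tsum_mul_left]
    refine ENNReal.tsum_le_tsum fun i ↦ ?_
    rw [lintegral_indicator_const (measurableSet_toMeasurable _ _), measure_toMeasurable]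
    rcases (T j i).eq_empty_or_nonempty with h | h
    · simp [h]
    · simp only [h, iSup_pos]
      have hdiam : volume (u '' (T j i ∩ A)) ≤ b * Metric.ediam (T j i) := by
        refine (Real.volume_le_diam _).trans (Metric.ediam_le ?_)
        rintro _ ⟨x, ⟨hx, hxA⟩, rfl⟩ _ ⟨y, ⟨hy, hyA⟩, rfl⟩
        have hxy := Metric.edist_le_ediam_of_mem hx hy
        refine (hu x hxA y hyA ?_).trans (mul_le_mul_right hxy b)
        exact hxy.trans_lt (((hT2 j i).trans (min_le_left _ _)).trans_lt hδ')
      calc _ ≤ Metric.ediam (T j i) ^ k * (b * Metric.ediam (T j i)) := by gcongr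
        _ = _ := by
          rw [ENNReal.rpow_add_of_nonneg _ _ hk zero_le_one, ENNReal.rpow_one]
          ring
  refine ⟨fun t ↦ liminf (fun j ↦ Ψ j t) atTop, .liminf hΨm, fun t ↦ ?_, ?_⟩
  -- Only pieces meeting the fiber are indexed: for `k = 0` every other piece would add 1 to the
  -- sum.
  · have := Measure.hausdorffMeasure_le_liminf_tsum (β := ℕ)
      (ι := fun j ↦ {i : ℕ // t ∈ u '' (T j i ∩ A)}) k (A ∩ u ⁻¹' {t}) r hrlim
      (fun j i ↦ T j i) (Eventually.of_forall fun j i ↦ hT2 j i)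
      (Eventually.of_forall fun j x hx ↦ by
        obtain ⟨i, hi⟩ := mem_iUnion.1 (hT1 j hx.1)
        exact mem_iUnion.2 ⟨⟨i, x, ⟨hi, hx.1⟩, hx.2⟩, hi⟩)
    refine this.trans (liminf_le_liminf (Eventually.of_forall fun j ↦ ?_))
    refine (tsum_subtype {i : ℕ | t ∈ u '' (T j i ∩ A)}
      (fun i ↦ Metric.ediam (T j i) ^ k)).trans_le (ENNReal.tsum_le_tsum fun i ↦ ?_)
    by_cases h : t ∈ u '' (T j i ∩ A)
    · rw [indicator_of_mem (by exact h), indicator_of_mem (subset_toMeasurable _ _ h)]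
    · rw [indicator_of_notMem (by exact h)]
      exact zero_le
  · refine (lintegral_liminf_le hΨm).trans ((liminf_le_liminf
      (Eventually.of_forall hΨi)).trans_eq (Tendsto.liminf_eq ?_))
    have := ENNReal.Tendsto.const_mul (a := b) (tendsto_const_nhds (x := μH[k + 1] A) |>.add hinv)
      (Or.inr hb')
    simpa using this

open MeasureTheory Set Filter Topology in
/-- If `φ` has measurable majorants with integrals bounded by `J n → I`, then it has one with
integral at most `I`. -/
theorem exists_measurable_le_of_forall_seq {φ : ℝ → ℝ≥0∞} {I : ℝ≥0∞} {J : ℕ → ℝ≥0∞}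
    (hJ : Tendsto J atTop (𝓝 I))
    (h : ∀ n, ∃ ψ : ℝ → ℝ≥0∞, Measurable ψ ∧ (∀ t, φ t ≤ ψ t) ∧ ∫⁻ t, ψ t ≤ J n) :
    ∃ ψ : ℝ → ℝ≥0∞, Measurable ψ ∧ (∀ t, φ t ≤ ψ t) ∧ ∫⁻ t, ψ t ≤ I := by
  choose ψ hm hle hint using h
  refine ⟨fun t ↦ liminf (fun n ↦ ψ n t) atTop, .liminf hm, fun t ↦ ?_, ?_⟩
  · exact le_liminf_of_le (by isBoundedDefault) (Eventually.of_forall fun n ↦ hle n t)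
  · exact (lintegral_liminf_le hm).trans
      ((liminf_le_liminf (Eventually.of_forall hint)).trans_eq hJ.liminf_eq)

open MeasureTheory Set Filter Topology in
/-- The coarea inequality for the measure of a set. -/
theorem exists_measurable_hausdorffMeasure_fiber_le_setLIntegral {X : Type*} [MetricSpace X]
    [MeasurableSpace X] [BorelSpace X] {k : ℝ} (hk : 0 ≤ k) (u : X → ℝ)
    (ρ : X → ℝ≥0∞) (hρ : Measurable ρ) (hρ' : ∀ x, ρ x ≠ ∞)
    (hfin : μH[k + 1] (univ : Set X) ≠ ∞)
    {δ : ℝ≥0∞} (hδ : 0 < δ)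
    (hu : ∀ x y, edist x y < δ → edist (u x) (u y) ≤ max (ρ x) (ρ y) * edist x y)
    {A : Set X} (hA : MeasurableSet A) :
    ∃ ψ : ℝ → ℝ≥0∞, Measurable ψ ∧ (∀ t, μH[k] (A ∩ u ⁻¹' {t}) ≤ ψ t) ∧
      ∫⁻ t, ψ t ≤ ∫⁻ x in A, ρ x ∂μH[k + 1] := by
  have hlim : Tendsto (fun n : ℕ ↦ ∫⁻ x in A, ρ x ∂μH[k + 1] +
      ((n : ℝ≥0∞) + 1)⁻¹ * μH[k + 1] A) atTop (𝓝 (∫⁻ x in A, ρ x ∂μH[k + 1])) := by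
    have h1 : Tendsto (fun j : ℕ ↦ ((j : ℝ≥0∞) + 1)⁻¹) atTop (𝓝 0) := by
      have := (tendsto_add_atTop_iff_nat 1).2 ENNReal.tendsto_inv_nat_nhds_zero
      simpa using this
    have := (tendsto_const_nhds (x := ∫⁻ x in A, ρ x ∂μH[k + 1])).add
      (ENNReal.Tendsto.mul_const (b := μH[k + 1] A) h1
        (Or.inr (measure_ne_top_of_subset (subset_univ A) hfin)))
    simpa using this
  refine exists_measurable_le_of_forall_seq hlim fun n ↦ ?_
  -- Slice `A` into layers where `j ε ≤ ρ ≤ (j + 1) ε`. On each layer the Lipschitz bound is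
  -- constant, and the total error is at most `ε μH[k + 1] A`.
  set ε : ℝ≥0∞ := ((n : ℝ≥0∞) + 1)⁻¹ with hε
  have hε0 : ε ≠ 0 := ENNReal.inv_ne_zero.2 (by finiteness)
  have hεt : ε ≠ ∞ := ENNReal.inv_ne_top.2 (by simp)
  set q : X → ℕ := fun x ↦ ⌊(ρ x / ε).toNNReal⌋₊ with hq
  have hqm : Measurable q := Nat.measurable_floor.comp (hρ.div_const ε).ennreal_toNNReal
  have hfinx : ∀ x, ρ x / ε ≠ ∞ := fun x ↦ ENNReal.div_ne_top (hρ' x) hε0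
  have hq1 : ∀ x, (q x : ℝ≥0∞) * ε ≤ ρ x := by
    intro x
    rw [← ENNReal.le_div_iff_mul_le (Or.inl hε0) (Or.inl hεt), ← ENNReal.coe_toNNReal (hfinx x)]
    exact_mod_cast Nat.floor_le (zero_le : 0 ≤ (ρ x / ε).toNNReal)
  have hq2 : ∀ x, ρ x ≤ ((q x : ℝ≥0∞) + 1) * ε := by
    intro x
    rw [← ENNReal.div_le_iff_le_mul (Or.inl hε0) (Or.inl hεt), ← ENNReal.coe_toNNReal (hfinx x)]
    exact_mod_cast (Nat.lt_floor_add_one (ρ x / ε).toNNReal).le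
  have hpart : ∀ j : ℕ, ∃ ψ : ℝ → ℝ≥0∞, Measurable ψ ∧
      (∀ t, μH[k] ((A ∩ q ⁻¹' {j}) ∩ u ⁻¹' {t}) ≤ ψ t) ∧
      ∫⁻ t, ψ t ≤ (((j : ℝ≥0∞) + 1) * ε) * μH[k + 1] (A ∩ q ⁻¹' {j}) := by
    intro j
    refine exists_measurable_hausdorffMeasure_fiber_le hk u _ (mul_ne_zero (by simp) hε0)
      (ENNReal.mul_ne_top (by finiteness) hεt) hδ ?_
    rintro x ⟨-, hx⟩ y ⟨-, hy⟩ hxy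
    refine (hu x y hxy).trans (mul_le_mul_left (max_le ?_ ?_) _)
    · simpa [show q x = j from hx] using hq2 x
    · simpa [show q y = j from hy] using hq2 y
  choose ψ hm hle hint using hpart
  have hcover : ⋃ j, A ∩ q ⁻¹' {j} = A := by
    ext x; simp
  have hAm : ∀ j, MeasurableSet (A ∩ q ⁻¹' {j}) := fun j ↦
    hA.inter (hqm (measurableSet_singleton j))
  have hdisj : Pairwise (Function.onFun Disjoint fun j ↦ A ∩ q ⁻¹' {j}) := by
    intro i j hij
    refine Set.disjoint_left.2 fun x hx hy ↦ hij ?_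
    exact (show q x = i from hx.2).symm.trans (show q x = j from hy.2)
  refine ⟨fun t ↦ ∑' j, ψ j t, Measurable.tsum hm, fun t ↦ ?_, ?_⟩
  · calc μH[k] (A ∩ u ⁻¹' {t}) = μH[k] (⋃ j, (A ∩ q ⁻¹' {j}) ∩ u ⁻¹' {t}) := by
          rw [← iUnion_inter, hcover]
      _ ≤ ∑' j, μH[k] ((A ∩ q ⁻¹' {j}) ∩ u ⁻¹' {t}) := measure_iUnion_le _
      _ ≤ _ := ENNReal.tsum_le_tsum fun j ↦ hle j t
  · rw [lintegral_tsum fun j ↦ (hm j).aemeasurable]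
    calc ∑' j, ∫⁻ t, ψ j t
        ≤ ∑' j, ∫⁻ x in A ∩ q ⁻¹' {j}, (ρ x + ε) ∂μH[k + 1] := by
          refine ENNReal.tsum_le_tsum fun j ↦ (hint j).trans ?_
          rw [← setLIntegral_const]
          refine setLIntegral_mono' (hAm j) fun x hx ↦ ?_
          have := hq1 x
          rw [show q x = j from hx.2] at this
          rw [add_mul, one_mul]
          gcongr
      _ = ∫⁻ x in A, (ρ x + ε) ∂μH[k + 1] := by
          rw [← lintegral_iUnion hAm hdisj, hcover]
      _ = _ := by
          rw [lintegral_add_right _ measurable_const, setLIntegral_const]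

open MeasureTheory Set Filter Topology in
/-- The coarea inequality, with a measurable majorant of the (possibly non-measurable) integrals
over the level sets. -/
theorem exists_measurable_lintegral_fiber_le {X : Type*} [MetricSpace X]
    [MeasurableSpace X] [BorelSpace X] {k : ℝ} (hk : 0 ≤ k) (u : X → ℝ)
    (ρ : X → ℝ≥0∞) (hρ : Measurable ρ) (hρ' : ∀ x, ρ x ≠ ∞)
    (hfin : μH[k + 1] (univ : Set X) ≠ ∞)
    {δ : ℝ≥0∞} (hδ : 0 < δ)
    (hu : ∀ x y, edist x y < δ → edist (u x) (u y) ≤ max (ρ x) (ρ y) * edist x y)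
    {g : X → ℝ≥0∞} (hg : Measurable g) :
    ∃ ψ : ℝ → ℝ≥0∞, Measurable ψ ∧ (∀ t, ∫⁻ x in u ⁻¹' {t}, g x ∂μH[k] ≤ ψ t) ∧
      ∫⁻ t, ψ t ≤ ∫⁻ x, g x * ρ x ∂μH[k + 1] := by
  refine Measurable.ennreal_induction (motive := fun g ↦ ∃ ψ : ℝ → ℝ≥0∞, Measurable ψ ∧
    (∀ t, ∫⁻ x in u ⁻¹' {t}, g x ∂μH[k] ≤ ψ t) ∧
      ∫⁻ t, ψ t ≤ ∫⁻ x, g x * ρ x ∂μH[k + 1]) ?_ ?_ ?_ hg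
  · intro c s hs
    obtain ⟨ψ, hm, hle, hint⟩ := exists_measurable_hausdorffMeasure_fiber_le_setLIntegral hk u ρ
      hρ hρ' hfin hδ hu hs
    refine ⟨fun t ↦ c * ψ t, hm.const_mul c, fun t ↦ ?_, ?_⟩
    · rw [lintegral_indicator_const hs, Measure.restrict_apply hs]
      exact mul_le_mul_right (hle t) c
    · rw [lintegral_const_mul _ hm]
      refine (mul_le_mul_right hint c).trans_eq ?_
      rw [← lintegral_const_mul _ hρ, ← lintegral_indicator hs]
      refine lintegral_congr fun x ↦ ?_
      by_cases hx : x ∈ s <;> simp [hx]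
  · intro f g _ hf hg ihf ihg
    obtain ⟨ψ, hm, hle, hint⟩ := ihf
    obtain ⟨ψ', hm', hle', hint'⟩ := ihg
    refine ⟨ψ + ψ', hm.add hm', fun t ↦ ?_, ?_⟩
    · simp only [Pi.add_apply]
      rw [lintegral_add_left hf]
      exact add_le_add (hle t) (hle' t)
    · simp only [Pi.add_apply, add_mul]
      rw [lintegral_add_left hm, lintegral_add_left (f := fun x ↦ f x * ρ x) (hf.mul hρ)]
      exact add_le_add hint hint'
  · intro f hf hmono ih
    choose ψ hm hle hint using ih
    -- The majorants chosen for the `f n` need not increase with `n`, so Fatou's lemma replaces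
    -- monotone convergence.
    refine ⟨fun t ↦ liminf (fun n ↦ ψ n t) atTop, .liminf hm, fun t ↦ ?_, ?_⟩
    · rw [lintegral_iSup hf hmono]
      have h1 : Tendsto (fun n ↦ ∫⁻ x in u ⁻¹' {t}, f n x ∂μH[k]) atTop
          (𝓝 (⨆ n, ∫⁻ x in u ⁻¹' {t}, f n x ∂μH[k])) :=
        tendsto_atTop_iSup fun i j hij ↦ lintegral_mono (hmono hij)
      rw [← h1.liminf_eq]
      exact liminf_le_liminf (Eventually.of_forall fun n ↦ hle n t)
    · refine (lintegral_liminf_le hm).trans ?_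
      refine liminf_le_of_le (by isBoundedDefault) fun b hb ↦ ?_
      obtain ⟨n, hn⟩ := hb.exists
      refine hn.trans ((hint n).trans (lintegral_mono fun x ↦ ?_))
      exact mul_le_mul_left (le_iSup (fun n ↦ f n x) n) _

/-! ### Curves as limits of chains. -/

open MeasureTheory Set MetricModulus in
/-- The arc length integral over a curve parametrized with speed at most one is at most the
integral in the parameter. -/
theorem MetricModulus.Curve.lineIntegral_le_of_lipschitzWith_one {X : Type*} [MetricSpace X]
    (γ : Curve X) (h : LipschitzWith 1 γ.toFun) (ρ : X → ℝ≥0∞) :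
    γ.Rectifiable ∧ γ.lineIntegral ρ ≤ ∫⁻ t in Icc γ.a γ.b, ρ (γ.toFun t) := by
  have hvar : ∀ s t, eVariationOn γ.toFun (Icc s t) ≤ ENNReal.ofReal (t - s) := fun s t ↦ by
    have := h.lipschitzOnWith (s := univ) |>.comp_eVariationOn_le (g := id) (s := Icc s t)
      (mapsTo_univ _ _)
    simpa [eVariationOn_id_Icc] using this
  have hrect : γ.Rectifiable := (hvar _ _).trans_lt ENNReal.ofReal_lt_top
  refine ⟨hrect, ?_⟩
  set s := Icc γ.a γ.b with hs
  have ha : γ.a ∈ s := left_mem_Icc.2 γ.le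
  have hbv : LocallyBoundedVariationOn γ.toFun s :=
    BoundedVariationOn.locallyBoundedVariationOn hrect.ne
  set l : ℝ → ℝ := variationOnFromTo γ.toFun s γ.a with hl
  have hmono : MonotoneOn l s := variationOnFromTo.monotoneOn hbv ha
  have hlip : LipschitzOnWith 1 l s := by
    refine LipschitzOnWith.of_le_add fun x hx y hy ↦ ?_
    rcases le_total x y with hxy | hxy
    · exact (hmono hx hy hxy).trans (le_add_of_nonneg_right dist_nonneg)
    · have h1 := variationOnFromTo.add hbv ha hy hx
      have h2 : variationOnFromTo γ.toFun s y x ≤ x - y := by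
        rw [variationOnFromTo.eq_of_le _ _ hxy]
        refine ENNReal.toReal_le_of_le_ofReal (by linarith) ?_
        exact (eVariationOn.mono _ inter_subset_right).trans (hvar _ _)
      rw [Real.dist_eq, abs_of_nonneg (by linarith)]
      simp only [hl]
      linarith
  have hla : l γ.a = 0 := variationOnFromTo.self _ _ _
  have hlb : l γ.b = γ.length.toReal := by
    simp only [hl]
    rw [variationOnFromTo.eq_of_le _ _ γ.le, ← hs, inter_self]
    rfl
  have haem : AEMeasurable l (volume.restrict s) :=
    hlip.continuousOn.aemeasurable measurableSet_Icc
  -- The arc-length function `l` is 1-Lipschitz and maps onto `[0, length]`. It does not increase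
  -- Lebesgue measure, so the pushforward dominates.
  have hmeas : volume.restrict (Icc 0 γ.length.toReal) ≤ (volume.restrict s).map l := by
    refine Measure.le_iff.2 fun B hB ↦ ?_
    rw [Measure.restrict_apply hB, Measure.map_apply_of_aemeasurable haem hB,
      Measure.restrict_apply' measurableSet_Icc]
    calc volume (B ∩ Icc 0 γ.length.toReal) ≤ volume (l '' (l ⁻¹' B ∩ s)) := by
          refine measure_mono ?_
          rintro y ⟨hyB, hy⟩
          rw [← hla, ← hlb] at hy
          obtain ⟨x, hx, rfl⟩ := intermediate_value_Icc γ.le hlip.continuousOn hy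
          exact ⟨x, ⟨hyB, hx⟩, rfl⟩
      _ ≤ volume (l ⁻¹' B ∩ s) := by
          have := (hlip.mono inter_subset_right).hausdorffMeasure_image_le
            (s := l ⁻¹' B ∩ s) zero_le_one
          simpa [hausdorffMeasure_real] using this
  calc γ.lineIntegral ρ ≤ ∫⁻ y, ρ (γ.arcLength y) ∂((volume.restrict s).map l) :=
        lintegral_mono' hmeas le_rfl
    _ ≤ ∫⁻ t in s, ρ (γ.arcLength (l t)) := lintegral_map_le _ _
    _ = ∫⁻ t in s, ρ (γ.toFun t) := by
        refine setLIntegral_congr_fun measurableSet_Icc fun t ht ↦ ?_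
        have := edist_naturalParameterization_eq_zero hbv ha ht
        exact congrArg ρ (edist_eq_zero.1 this)

/-- The length of the part of the sequence `x` up to the index `i`. -/
noncomputable def chainLength {X : Type*} [MetricSpace X] (x : ℕ → X) (i : ℕ) : ℝ :=
  ∑ j ∈ Finset.range i, dist (x j) (x (j + 1))

/-- The last index up to `K` at which the chain `x` has length at most `t`. -/
noncomputable def chainIndex {X : Type*} [MetricSpace X] (x : ℕ → X) (K : ℕ) (t : ℝ) : ℕ :=
  open Classical in Nat.findGreatest (fun i ↦ chainLength x i ≤ t) K

section chain

variable {X : Type*} [MetricSpace X] (x : ℕ → X) (K : ℕ)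

theorem monotone_chainLength : Monotone (chainLength x) :=
  monotone_nat_of_le_succ fun n ↦ by
    rw [chainLength, chainLength, Finset.sum_range_succ]
    exact le_add_of_nonneg_right dist_nonneg

theorem chainLength_nonneg (i : ℕ) : 0 ≤ chainLength x i :=
  Finset.sum_nonneg fun _ _ ↦ dist_nonneg

theorem chainLength_succ (i : ℕ) :
    chainLength x (i + 1) = chainLength x i + dist (x i) (x (i + 1)) :=
  Finset.sum_range_succ _ _

theorem dist_le_chainLength_sub {i j : ℕ} (h : i ≤ j) :
    dist (x i) (x j) ≤ chainLength x j - chainLength x i := by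
  refine (dist_le_Ico_sum_dist x h).trans_eq ?_
  rw [Finset.sum_Ico_eq_sub _ h]
  rfl

theorem monotone_chainIndex : Monotone (chainIndex x K) := fun _ _ hst ↦
  Nat.findGreatest_mono_left (fun _ h ↦ le_trans h hst) K

theorem chainIndex_le (t : ℝ) : chainIndex x K t ≤ K := Nat.findGreatest_le K

theorem chainLength_chainIndex_le {t : ℝ} (ht : 0 ≤ t) :
    chainLength x (chainIndex x K t) ≤ t := by
  classical
  exact Nat.findGreatest_spec (P := fun i ↦ chainLength x i ≤ t) (Nat.zero_le K)
    (by simpa [chainLength] using ht)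

theorem lt_chainLength_of_chainIndex_lt {t : ℝ} {i : ℕ} (h : chainIndex x K t < i) (hi : i ≤ K) :
    t < chainLength x i := by
  classical
  exact not_le.1 (Nat.findGreatest_is_greatest h hi)

/-- At time `s` the chain has been followed up to a length that lags behind `s` by at most one step,
and at time `t` the length does not exceed `t`. -/
theorem dist_chainIndex_le {ε : ℝ} (hε : ∀ i < K, dist (x i) (x (i + 1)) ≤ ε) (hε0 : 0 ≤ ε)
    {s t : ℝ} (hs : 0 ≤ s) (hst : s ≤ t) :
    dist (x (chainIndex x K s)) (x (chainIndex x K t)) ≤ t - s + ε := by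
  rcases (chainIndex_le x K s).eq_or_lt with h | h
  · have : chainIndex x K t = K :=
      le_antisymm (chainIndex_le x K t) (h.symm.trans_le (monotone_chainIndex x K hst))
    rw [this, h, dist_self]
    linarith
  · have h1 := lt_chainLength_of_chainIndex_lt x K (Nat.lt_succ_self _) (Nat.succ_le_of_lt h)
    rw [Nat.succ_eq_add_one, chainLength_succ] at h1
    have h2 := dist_le_chainLength_sub x (monotone_chainIndex x K hst)
    have h3 := chainLength_chainIndex_le x K (hs.trans hst)
    have h4 := hε _ h
    linarith

/-- Initial steps of length zero can make the index positive, but they do not move the point. -/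
theorem chainIndex_zero_eq : x (chainIndex x K 0) = x 0 := by
  have h := dist_le_chainLength_sub x (Nat.zero_le (chainIndex x K 0))
  have h1 := chainLength_chainIndex_le x K le_rfl
  have h2 := chainLength_nonneg x 0
  exact (dist_le_zero.1 (by linarith)).symm

theorem chainIndex_chainLength_eq : chainIndex x K (chainLength x K) = K := by
  classical
  exact Nat.findGreatest_eq (P := fun i ↦ chainLength x i ≤ chainLength x K) le_rfl

-- The index equals `i` on `[chainLength x i, chainLength x (i + 1))`, so the integral is a
-- left-endpoint Riemann sum.
open MeasureTheory Set in
theorem setLIntegral_chainIndex_le (f : ℕ → ℝ≥0∞) :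
    ∫⁻ t in Ico 0 (chainLength x K), f (chainIndex x K t) ≤
      ∑ i ∈ Finset.range K, f i * edist (x i) (x (i + 1)) := by
  have hsub : Ico 0 (chainLength x K) ⊆
      ⋃ i : Fin K, Ico (chainLength x i) (chainLength x (i + 1)) := by
    intro t ht
    have hi : chainIndex x K t < K := by
      by_contra! h
      have h1 := chainLength_chainIndex_le x K ht.1
      have h2 := monotone_chainLength x h
      linarith [ht.2]
    exact mem_iUnion.2 ⟨⟨_, hi⟩, chainLength_chainIndex_le x K ht.1,
      lt_chainLength_of_chainIndex_lt x K (Nat.lt_succ_self _) (Nat.succ_le_of_lt hi)⟩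
  refine (lintegral_mono_set hsub).trans ((lintegral_iUnion_le _ _).trans ?_)
  rw [tsum_fintype, Finset.sum_range]
  refine Finset.sum_le_sum fun i _ ↦ le_of_eq ?_
  have hconst : ∀ t ∈ Ico (chainLength x i) (chainLength x (i + 1)),
      f (chainIndex x K t) = f i := by
    intro t ht
    congr 1
    refine le_antisymm ?_ ?_
    · by_contra! h
      have h1 := chainLength_chainIndex_le x K ((chainLength_nonneg x i).trans ht.1)
      have h2 := monotone_chainLength x (Nat.succ_le_of_lt h)
      rw [Nat.succ_eq_add_one] at h2
      linarith [ht.2]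
    · by_contra! h
      linarith [lt_chainLength_of_chainIndex_lt x K h i.2.le, ht.1]
  rw [setLIntegral_congr_fun measurableSet_Ico hconst, setLIntegral_const, Real.volume_Ico,
    chainLength_succ, add_sub_cancel_left, edist_dist]

end chain

open Filter Topology Set in
/-- A sequence of maps of the half-line into a compact space that is asymptotically 1-Lipschitz has
a subsequence that converges pointwise to a 1-Lipschitz map. -/
theorem exists_subseq_tendsto_of_asymptotically_lipschitz {X : Type*} [MetricSpace X]
    [CompactSpace X] (f : ℕ → ℝ → X) (ε : ℕ → ℝ) (hε : Tendsto ε atTop (𝓝 0))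
    (hf : ∀ n s t, dist (f n s) (f n t) ≤ |s - t| + ε n)
    (l : ℕ → ℝ) {L : ℝ} (hl : ∀ n, l n ∈ Icc 0 L) :
    ∃ (φ : ℕ → ℕ) (g : ℝ → X) (m : ℝ), StrictMono φ ∧ LipschitzWith 1 g ∧ m ∈ Icc 0 L ∧
      (∀ t, Tendsto (fun n ↦ f (φ n) t) atTop (𝓝 (g t))) ∧
      Tendsto (fun n ↦ l (φ n)) atTop (𝓝 m) := by
  -- Arzelà–Ascoli: compactness of `ℚ → X` gives convergence at rational times, and the asymptotic
  -- Lipschitz bound extends it to all times.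
  obtain ⟨⟨y, m⟩, ⟨-, hm⟩, φ, hφ, hlim⟩ :=
    (isCompact_univ (X := ℚ → X) |>.prod (isCompact_Icc (a := (0 : ℝ)) (b := L))).tendsto_subseq
      (x := fun n ↦ (fun q : ℚ ↦ f n q, l n)) fun n ↦ ⟨mem_univ _, hl n⟩
  rw [Prod.tendsto_iff] at hlim
  obtain ⟨hlim1, hlim2⟩ := hlim
  have hq : ∀ q : ℚ, Tendsto (fun n ↦ f (φ n) q) atTop (𝓝 (y q)) := fun q ↦
    (tendsto_pi_nhds.1 hlim1) q
  have hεφ : Tendsto (fun n ↦ ε (φ n)) atTop (𝓝 0) := hε.comp hφ.tendsto_atTop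
  have hconv : ∀ t, ∃ x, Tendsto (fun n ↦ f (φ n) t) atTop (𝓝 x) := by
    intro t
    refine cauchySeq_tendsto_of_complete (Metric.cauchySeq_iff.2 fun η hη ↦ ?_)
    obtain ⟨q, hq1, hq2⟩ := exists_rat_btwn (show t < t + η / 8 by linarith)
    obtain ⟨M, hM⟩ := Metric.cauchySeq_iff.1 (hq q).cauchySeq (η / 4) (by linarith)
    obtain ⟨M', hM'⟩ := eventually_atTop.1
      (hεφ.eventually (gt_mem_nhds (show 0 < η / 8 by linarith)))
    refine ⟨max M M', fun i hi j hj ↦ ?_⟩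
    have h1 := hM i (le_of_max_le_left hi) j (le_of_max_le_left hj)
    have h2 := hM' i (le_of_max_le_right hi)
    have h3 := hM' j (le_of_max_le_right hj)
    have h4 := hf (φ i) t q
    have h5 := hf (φ j) q t
    have h6 := dist_triangle4 (f (φ i) t) (f (φ i) q) (f (φ j) q) (f (φ j) t)
    rw [abs_of_nonpos (by linarith)] at h4
    rw [abs_of_nonneg (by linarith)] at h5
    linarith
  choose g hg using hconv
  refine ⟨φ, g, m, hφ, LipschitzWith.of_dist_le_mul fun s t ↦ ?_, hm, hg, hlim2⟩
  have h1 : Tendsto (fun n ↦ |s - t| + ε (φ n)) atTop (𝓝 (|s - t| + 0)) :=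
    tendsto_const_nhds.add hεφ
  have := le_of_tendsto_of_tendsto' ((hg s).dist (hg t)) h1 fun n ↦ hf (φ n) s t
  simpa [Real.dist_eq] using this

theorem ofReal_chainLength {X : Type*} [MetricSpace X] (x : ℕ → X) (K : ℕ) :
    ENNReal.ofReal (chainLength x K) = ∑ i ∈ Finset.range K, edist (x i) (x (i + 1)) := by
  rw [chainLength, ENNReal.ofReal_sum_of_nonneg fun _ _ ↦ dist_nonneg]
  simp only [edist_dist]

open Filter Topology Set MeasureTheory MetricModulus in
/-- If there are chains from `E` to `F` of bounded cost and with steps of size tending to zero, then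
there is a curve from `E` to `F` of bounded cost. -/
theorem exists_curve_of_chains {X : Type*} [MetricSpace X] [CompactSpace X] {E F : Set X}
    (hE : IsClosed E) (hF : IsClosed F) {ρ : X → ℝ≥0∞} (hρ : LowerSemicontinuous ρ)
    {c : ℝ≥0∞} (hc0 : c ≠ 0) (hc1 : c ≤ 1) (hcρ : ∀ x, c ≤ ρ x) {a : ℝ≥0∞} (ha : a ≠ ∞)
    (h : ∀ n : ℕ, ∃ (K : ℕ) (x : ℕ → X), x 0 ∈ E ∧ x K ∈ F ∧
      (∀ i < K, dist (x i) (x (i + 1)) ≤ 1 / ((n : ℝ) + 1)) ∧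
      ∑ i ∈ Finset.range K, min (ρ (x i)) ((n : ℝ≥0∞) + 1) * edist (x i) (x (i + 1)) ≤ a) :
    ∃ γ ∈ connectingCurves E F, γ.Rectifiable ∧ γ.lineIntegral ρ ≤ a := by
  choose K x hxE hxF hstep hcost using h
  set ε : ℕ → ℝ := fun n ↦ 1 / ((n : ℝ) + 1) with hε
  have hεlim : Tendsto ε atTop (𝓝 0) := tendsto_one_div_add_atTop_nhds_zero_nat
  have hε0 : ∀ n, 0 ≤ ε n := fun n ↦ by positivity
  set f : ℕ → ℝ → X := fun n t ↦ x n (chainIndex (x n) (K n) (max t 0)) with hfdef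
  set l : ℕ → ℝ := fun n ↦ chainLength (x n) (K n) with hldef
  -- The weight stays at least `c` after truncation since `c ≤ 1 ≤ n + 1`. Hence `c` times the
  -- length is at most `a`.
  have hl : ∀ n, l n ∈ Icc 0 (a / c).toReal := by
    refine fun n ↦ ⟨chainLength_nonneg _ _, ?_⟩
    refine (ENNReal.ofReal_le_iff_le_toReal (ENNReal.div_ne_top ha hc0)).1 ?_
    rw [ENNReal.le_div_iff_mul_le (Or.inl hc0) (Or.inr ha), ofReal_chainLength, mul_comm,
      Finset.mul_sum]
    refine (Finset.sum_le_sum fun i _ ↦ mul_le_mul_left (le_min (hcρ _) ?_) _).trans (hcost n)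
    exact hc1.trans le_add_self
  have hf : ∀ n s t, dist (f n s) (f n t) ≤ |s - t| + ε n := by
    intro n s t
    wlog hst : s ≤ t generalizing s t
    · rw [dist_comm, abs_sub_comm]
      exact this t s (not_le.1 hst).le
    have h1 := dist_chainIndex_le (x n) (K n) (hstep n) (hε0 n) (le_max_right s 0)
      (max_le_max_right 0 hst)
    have h2 := max_sub_max_le_max t 0 s 0
    rw [abs_sub_comm, abs_of_nonneg (by linarith)]
    refine h1.trans ?_
    have h3 : max (t - s) (0 - 0) = t - s := max_eq_left (by linarith)
    linarith
  obtain ⟨φ, g, m, hφ, hg, hm, hfg, hlm⟩ :=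
    exists_subseq_tendsto_of_asymptotically_lipschitz f ε hεlim hf l hl
  have hεφ : Tendsto (fun n ↦ ε (φ n)) atTop (𝓝 0) := hεlim.comp hφ.tendsto_atTop
  have hg0 : g 0 ∈ E := by
    refine hE.mem_of_tendsto (hfg 0) (Eventually.of_forall fun n ↦ ?_)
    simp only [hfdef, max_self, chainIndex_zero_eq]
    exact hxE _
  have hgm : g m ∈ F := by
    have h1 : Tendsto (fun n ↦ f (φ n) (l (φ n))) atTop (𝓝 (g m)) := by
      refine (tendsto_iff_of_dist ?_).1 (hfg m)
      have h2 : Tendsto (fun n ↦ |m - l (φ n)| + ε (φ n)) atTop (𝓝 (|m - m| + 0)) :=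
        ((tendsto_const_nhds.sub hlm).abs).add hεφ
      simp only [sub_self, abs_zero, add_zero] at h2
      exact squeeze_zero (fun _ ↦ dist_nonneg) (fun n ↦ hf _ _ _) h2
    refine hF.mem_of_tendsto h1 (Eventually.of_forall fun n ↦ ?_)
    simp only [hfdef, max_eq_left (hl (φ n)).1]
    simp only [hldef, chainIndex_chainLength_eq]
    exact hxF _
  let γ : Curve X := ⟨0, m, hm.1, g, hg.continuous.continuousOn⟩
  obtain ⟨hγ, hγρ⟩ := γ.lineIntegral_le_of_lipschitzWith_one hg ρ
  refine ⟨γ, Or.inl ⟨hg0, hgm⟩, hγ, hγρ.trans ?_⟩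
  change ∫⁻ t in Icc 0 m, ρ (g t) ≤ a
  rw [setLIntegral_congr Ico_ae_eq_Icc.symm, ← lintegral_indicator measurableSet_Ico]
  set G : ℕ → ℝ → ℝ≥0∞ := fun n ↦ (Ico 0 (l n)).indicator fun t ↦
    min (ρ (x n (chainIndex (x n) (K n) t))) ((n : ℝ≥0∞) + 1) with hG
  have hGm : ∀ n, Measurable (G n) := by
    intro n
    refine Measurable.indicator ?_ measurableSet_Ico
    exact (measurable_from_top (f := fun i ↦ min (ρ (x n i)) ((n : ℝ≥0∞) + 1))).comp
      (monotone_chainIndex (x n) (K n)).measurable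
  have hGa : ∀ n, ∫⁻ t, G n t ≤ a := by
    intro n
    rw [lintegral_indicator measurableSet_Ico]
    exact (setLIntegral_chainIndex_le (x n) (K n)
      fun i ↦ min (ρ (x n i)) ((n : ℝ≥0∞) + 1)).trans (hcost n)
  -- Fatou's lemma: at each `t < m` the chain points tend to `g t`, `ρ` is lower semicontinuous
  -- there, and the cap `n + 1` tends to infinity.
  calc ∫⁻ t, (Ico 0 m).indicator (fun t ↦ ρ (g t)) t
      ≤ ∫⁻ t, liminf (fun n ↦ G (φ n) t) atTop := by
        refine lintegral_mono fun t ↦ ?_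
        by_cases ht : t ∈ Ico 0 m
        · rw [indicator_of_mem ht]
          refine le_of_forall_lt fun b hb ↦ ?_
          obtain ⟨b', hbb', hb'⟩ := exists_between hb
          refine hbb'.trans_le (le_liminf_of_le (by isBoundedDefault) ?_)
          obtain ⟨M, hM⟩ := ENNReal.exists_nat_gt (hb'.trans_le le_top).ne
          filter_upwards [(hfg t).eventually (hρ (g t) b' hb'), hlm.eventually (lt_mem_nhds ht.2),
            eventually_ge_atTop M] with n h1 h2 h3
          rw [hG]
          simp only
          rw [indicator_of_mem (show t ∈ Ico 0 (l (φ n)) from ⟨ht.1, h2⟩)]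
          refine le_min ?_ ?_
          · simp only [hfdef, max_eq_left ht.1] at h1
            exact h1.le
          · refine hM.le.trans (le_add_right ?_)
            exact_mod_cast h3.trans (hφ.id_le n)
        · rw [indicator_of_notMem ht]
          exact zero_le
    _ ≤ liminf (fun n ↦ ∫⁻ t, G (φ n) t) atTop := lintegral_liminf_le fun n ↦ hGm (φ n)
    _ ≤ a := by
        refine (liminf_le_liminf (Eventually.of_forall fun n ↦ hGa (φ n))).trans_eq ?_
        exact tendsto_const_nhds.liminf_eq

/-! ### The chain distance as a function with small-scale Lipschitz bound `w`. -/

section chainInf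

variable {X : Type*} [MetricSpace X] {E : Set X} {w : X → ℝ≥0∞} {δ : ℝ}

/-- The least cost, with respect to the weight `w`, of a chain from `E` to `y` with steps of size
at most `δ`. -/
noncomputable def chainInf (E : Set X) (w : X → ℝ≥0∞) (δ : ℝ) (y : X) : ℝ≥0∞ :=
  ⨅ (K : ℕ) (x : ℕ → X) (_ : x 0 ∈ E ∧ x K = y ∧ ∀ i < K, dist (x i) (x (i + 1)) ≤ δ),
    ∑ i ∈ Finset.range K, max (w (x i)) (w (x (i + 1))) * edist (x i) (x (i + 1))

theorem chainInf_le {K : ℕ} {x : ℕ → X} (h0 : x 0 ∈ E)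
    (hδ : ∀ i < K, dist (x i) (x (i + 1)) ≤ δ) :
    chainInf E w δ (x K) ≤
      ∑ i ∈ Finset.range K, max (w (x i)) (w (x (i + 1))) * edist (x i) (x (i + 1)) :=
  iInf_le_of_le K (iInf₂_le x ⟨h0, rfl, hδ⟩)

theorem chainInf_of_mem {y : X} (hy : y ∈ E) : chainInf E w δ y = 0 := by
  have := chainInf_le (w := w) (δ := δ) (K := 0) (x := fun _ ↦ y) hy (by simp)
  simpa using this

/-- Append the step from `y` to `z` to a chain ending at `y`. The maximum in the cost makes the
bound symmetric in `y` and `z`, as the coarea inequality requires. -/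
theorem chainInf_le_add {y z : X} (hyz : dist y z ≤ δ) :
    chainInf E w δ z ≤ chainInf E w δ y + max (w y) (w z) * edist y z := by
  conv_rhs => rw [chainInf]
  simp only [ENNReal.iInf_add]
  refine le_iInf fun K ↦ le_iInf₂ fun x hx ↦ ?_
  obtain ⟨h0, rfl, hδ⟩ := hx
  set x' : ℕ → X := fun i ↦ if i ≤ K then x i else z with hx'
  have h1 : ∀ i ≤ K, x' i = x i := fun i hi ↦ if_pos hi
  have h2 : x' (K + 1) = z := if_neg (by omega)
  have h3 : ∀ i < K + 1, dist (x' i) (x' (i + 1)) ≤ δ := by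
    intro i hi
    rcases (Nat.lt_succ_iff.1 hi).eq_or_lt with rfl | hi'
    · rwa [h1 _ le_rfl, h2]
    · rw [h1 _ hi'.le, h1 _ hi']
      exact hδ i hi'
  have := chainInf_le (w := w) (K := K + 1) (x := x') (by rwa [h1 _ (Nat.zero_le _)]) h3
  rw [h2, Finset.sum_range_succ, h1 K le_rfl, h2] at this
  refine this.trans_eq ?_
  congr 1
  refine Finset.sum_congr rfl fun i hi ↦ ?_
  have hi' := Finset.mem_range.1 hi
  rw [h1 _ hi'.le, h1 _ hi']

/-- The chain distance to `E`, truncated at one. -/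
noncomputable def truncChainInf (E : Set X) (w : X → ℝ≥0∞) (δ : ℝ) (y : X) : ℝ :=
  (min (chainInf E w δ y) 1).toReal

theorem edist_truncChainInf_le {y z : X} (hyz : dist y z ≤ δ) :
    edist (truncChainInf E w δ y) (truncChainInf E w δ z) ≤ max (w y) (w z) * edist y z := by
  have key : ∀ {y z : X}, dist y z ≤ δ → min (chainInf E w δ z) 1 ≤
      min (chainInf E w δ y) 1 + max (w y) (w z) * edist y z := by
    intro y z h
    rw [← min_add_add_right]
    exact min_le_min (chainInf_le_add h) le_self_add
  have hfin : ∀ y, min (chainInf E w δ y) 1 ≠ ∞ := fun y ↦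
    ((min_le_right _ _).trans_lt ENNReal.one_lt_top).ne
  rcases eq_or_ne (max (w y) (w z) * edist y z) ∞ with htop | htop
  · rw [htop]
    exact le_top
  · rw [edist_dist, Real.dist_eq]
    refine ENNReal.ofReal_le_of_le_toReal ?_
    have h1 := ENNReal.toReal_mono (ENNReal.add_ne_top.2 ⟨hfin y, htop⟩) (key hyz)
    have h2 := key (y := z) (z := y) (by rwa [dist_comm])
    rw [max_comm, edist_comm] at h2
    have h2 := ENNReal.toReal_mono (ENNReal.add_ne_top.2 ⟨hfin z, htop⟩) h2
    rw [ENNReal.toReal_add (hfin _) htop] at h1 h2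
    rw [truncChainInf, truncChainInf, abs_le]
    constructor <;> linarith

theorem continuous_truncChainInf (hδ : 0 < δ) {M : ℝ≥0∞} (hM : M ≠ ∞) (hw : ∀ x, w x ≤ M) :
    Continuous (truncChainInf E w δ) := by
  refine continuous_iff_continuousAt.2 fun y ↦ ?_
  refine EMetric.tendsto_nhds.2 fun ε hε ↦ ?_
  have hlim : Filter.Tendsto (fun z ↦ M * edist z y) (nhds y) (nhds 0) := by
    have h1 : Filter.Tendsto (fun z ↦ edist z y) (nhds y) (nhds 0) := by
      have := (continuous_id.edist (continuous_const (y := y))).tendsto y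
      simpa using this
    simpa using ENNReal.Tendsto.const_mul h1 (Or.inr hM)
  filter_upwards [hlim.eventually (gt_mem_nhds hε), Metric.closedBall_mem_nhds y hδ] with z h1 h2
  exact (edist_truncChainInf_le h2).trans_lt
    (lt_of_le_of_lt (mul_le_mul_left (max_le (hw z) (hw y)) _) h1)

end chainInf

/-! ### Duality of the two moduli. -/

open MeasureTheory Set Filter Topology MetricModulus

theorem MetricModulus.ballVol_pos {k : ℝ} (hk : 0 ≤ k) : 0 < ballVol k :=
  div_pos (Real.rpow_pos_of_pos Real.pi_pos _) (Real.Gamma_pos_of_pos (by positivity))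

theorem MetricModulus.mem_admCurves_of_le {X : Type*} [MetricSpace X] [MeasurableSpace X]
    [BorelSpace X] {Γ : Set (Curve X)} {ρ ρ' : X → ℝ≥0∞} (h : ρ ∈ AdmCurves Γ)
    (hm : Measurable ρ') (hle : ∀ x, ρ x ≤ ρ' x) : ρ' ∈ AdmCurves Γ :=
  ⟨hm, fun γ hγ hr ↦ (h.2 γ hγ hr).trans (lintegral_mono fun _ ↦ hle _)⟩

/-- Connecting curves are at least as long as a positive lower bound `r` for the distance between
`E` and `F`, so the constant `1 / r` is admissible. Finiteness is needed to pass to infima in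
products without meeting `0 * ∞`. -/
theorem MetricModulus.modCurves_connectingCurves_ne_top {X : Type*} [MetricSpace X]
    [MeasurableSpace X] [BorelSpace X] {N : ℝ} {E F : Set X}
    (hfin : hausdorff N (univ : Set X) < ∞) {p : ℝ}
    (hp : 0 ≤ p) (hE : IsCompact E) (hF : IsClosed F) (hEF : Disjoint E F) :
    modCurves N p (connectingCurves E F) ≠ ∞ := by
  obtain ⟨r, hr, hdist⟩ := Metric.exists_pos_forall_lt_edist hE hF hEF
  have hr0 : (r : ℝ≥0∞) ≠ 0 := by simpa using hr.ne'
  refine ((iInf₂_le (fun _ ↦ (r : ℝ≥0∞)⁻¹) ⟨measurable_const, fun γ hγ hrect ↦ ?_⟩).trans_lt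
    ?_).ne
  · rw [lintegral_const]
    exact ENNReal.mul_lt_top (ENNReal.rpow_lt_top_of_nonneg hp (ENNReal.inv_ne_top.2 hr0)) hfin
  · rw [Curve.lineIntegral, setLIntegral_const, Real.volume_Icc, sub_zero,
      ENNReal.ofReal_toReal hrect.ne, ← ENNReal.inv_mul_cancel hr0 ENNReal.coe_ne_top]
    refine mul_le_mul_right ?_ _
    have hends : edist (γ.toFun γ.a) (γ.toFun γ.b) ≤ γ.length :=
      eVariationOn.edist_le _ (left_mem_Icc.2 γ.le) (right_mem_Icc.2 γ.le)
    refine le_trans ?_ hends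
    rcases hγ with ⟨h1, h2⟩ | ⟨h1, h2⟩
    · exact (hdist _ h1 _ h2).le
    · rw [edist_comm]
      exact (hdist _ h2 _ h1).le

/-- Let `x` decrease to `M`. Finiteness of `M` provides such `x`, and finiteness of `B` makes
multiplication by `B` continuous even at 0. -/
theorem ENNReal.le_rpow_mul_of_forall_gt {κ M B : ℝ≥0∞} {s : ℝ} (hM : M ≠ ∞) (hB : B ≠ ∞)
    (h : ∀ x, M < x → κ ≤ x ^ s * B) : κ ≤ M ^ s * B := by
  have : (𝓝[>] M).NeBot := nhdsGT_neBot_of_exists_gt ⟨∞, hM.lt_top⟩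
  have hlim : Tendsto (fun x : ℝ≥0∞ ↦ x ^ s * B) (𝓝[>] M) (𝓝 (M ^ s * B)) :=
    ENNReal.Tendsto.mul_const
      ((ENNReal.continuous_rpow_const.tendsto M).mono_left nhdsWithin_le_nhds) (Or.inr hB)
  exact ge_of_tendsto hlim (eventually_mem_nhdsWithin.mono h)

section duality

variable {X : Type*} [MetricSpace X] [CompactSpace X] [MeasurableSpace X] [BorelSpace X]
  {N : ℝ} {E F : Set X}

/-- If every `n` failed, chains of cost below `a` with vanishing steps would produce a connecting
curve with integral at most `a < 1`. -/
theorem exists_le_chainInf (hE : IsClosed E) (hF : IsClosed F)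
    {ρ : X → ℝ≥0∞} (hρ : LowerSemicontinuous ρ) {c : ℝ≥0∞} (hc0 : c ≠ 0) (hc1 : c ≤ 1)
    (hcρ : ∀ x, c ≤ ρ x) (hadm : ρ ∈ AdmCurves (connectingCurves E F)) {a : ℝ≥0∞} (ha : a < 1) :
    ∃ n : ℕ, ∀ y ∈ F,
      a ≤ chainInf E (fun x ↦ min (ρ x) ((n : ℝ≥0∞) + 1)) (1 / ((n : ℝ) + 1)) y := by
  by_contra! h
  obtain ⟨γ, hγ, hrect, hint⟩ := exists_curve_of_chains hE hF hρ hc0 hc1 hcρ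
    (ha.trans_le le_top).ne fun n ↦ by
      obtain ⟨y, hy, hlt⟩ := h n
      simp only [chainInf, iInf_lt_iff] at hlt
      obtain ⟨K, x, ⟨h0, rfl, hδ⟩, hlt⟩ := hlt
      refine ⟨K, x, h0, hy, hδ, (Finset.sum_le_sum fun i _ ↦ ?_).trans hlt.le⟩
      exact mul_le_mul_left (le_max_left _ _) _
  exact absurd (hadm.2 γ hγ hrect) (not_le.2 (hint.trans_lt ha))

theorem one_le_lintegral_mul_of_lowerSemicontinuous (hN : 1 ≤ N)
    (hfin : μH[N] (univ : Set X) ≠ ∞) (hE : IsClosed E) (hF : IsClosed F)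
    {ρ : X → ℝ≥0∞} (hρ : LowerSemicontinuous ρ) {c : ℝ≥0∞} (hc0 : c ≠ 0) (hc1 : c ≤ 1)
    (hcρ : ∀ x, c ≤ ρ x) (hadm : ρ ∈ AdmCurves (connectingCurves E F))
    {g : X → ℝ≥0∞} (hg : g ∈ AdmMeasures (separatingMeasures N E F)) :
    1 ≤ ENNReal.ofReal (ballVol (N - 1) / 2 ^ (N - 1)) * ∫⁻ x, g x * ρ x ∂μH[N] := by
  refine le_of_forall_lt fun b hb ↦ ?_
  obtain ⟨a, hba, ha⟩ := exists_between hb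
  refine hba.trans_le ?_
  obtain ⟨n, hn⟩ := exists_le_chainInf hE hF hρ hc0 hc1 hcρ hadm ha
  set M : ℝ≥0∞ := (n : ℝ≥0∞) + 1 with hM
  have hMtop : M ≠ ∞ := by finiteness
  set w : X → ℝ≥0∞ := fun x ↦ min (ρ x) M with hw
  set δ : ℝ := 1 / ((n : ℝ) + 1) with hδ
  have hδ0 : 0 < δ := by positivity
  have hwM : ∀ x, w x ≤ M := fun x ↦ min_le_right _ _
  have hwm : Measurable w := hadm.1.min measurable_const
  set u := truncChainInf E w δ with hu
  have huc : Continuous u := continuous_truncChainInf hδ0 hMtop hwM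
  have hulip : ∀ x y, edist x y < ENNReal.ofReal δ →
      edist (u x) (u y) ≤ max (w x) (w y) * edist x y := fun x y hxy ↦
    edist_truncChainInf_le (by
      rw [edist_dist] at hxy
      exact ((ENNReal.ofReal_lt_ofReal_iff hδ0).1 hxy).le)
  have hcoarea := fun {g : X → ℝ≥0∞} (hg : Measurable g) ↦
    exists_measurable_lintegral_fiber_le (k := N - 1) (sub_nonneg.2 hN) u w hwm
      (fun x ↦ ((hwM x).trans_lt hMtop.lt_top).ne) (by rwa [sub_add_cancel])
      (ENNReal.ofReal_pos.2 hδ0) hulip hg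
  obtain ⟨ψ, hψm, hψ, hψint⟩ := hcoarea hg.1
  -- The coarea inequality with `g = 1` shows that almost every level set has finite measure, as
  -- membership in `separatingMeasures` demands.
  obtain ⟨χ, hχm, hχ, hχint⟩ := hcoarea (measurable_const (a := (1 : ℝ≥0∞)))
  rw [sub_add_cancel] at hψint hχint
  have hχfin : ∫⁻ t, χ t ≠ ∞ := by
    refine (hχint.trans_lt ?_).ne
    calc ∫⁻ x, 1 * w x ∂μH[N] ≤ ∫⁻ _, M ∂μH[N] := lintegral_mono fun x ↦ by simpa using hwM x
      _ = M * μH[N] (univ : Set X) := lintegral_const _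
      _ < ∞ := (ENNReal.mul_ne_top hMtop hfin).lt_top
  set C : ℝ≥0∞ := ENNReal.ofReal (ballVol (N - 1) / 2 ^ (N - 1)) with hC
  have hkey : ∀ᵐ t, t ∈ Ioo 0 a.toReal → 1 ≤ C * ψ t := by
    filter_upwards [ae_lt_top hχm hχfin] with t htfin ht
    have hfront : frontier {x | u x < t} ⊆ u ⁻¹' {t} := fun x hx ↦
      frontier_lt_subset_eq huc continuous_const hx
    have hsep : (hausdorff (N - 1)).restrict (frontier {x | u x < t}) ∈
        separatingMeasures N E F := by
      refine ⟨{x | u x < t}, isOpen_lt huc continuous_const, fun x hx ↦ ?_, ?_, rfl, ⟨?_⟩⟩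
      · simpa [hu, truncChainInf, chainInf_of_mem hx] using ht.1
      · have h1 : {x | t < u x} ⊆ interior {x | u x < t}ᶜ :=
          interior_maximal (fun x (hx : t < u x) ↦ not_lt.2 hx.le) (isOpen_lt continuous_const huc)
        refine fun x hx ↦ h1 (ht.2.trans_le ?_)
        refine ENNReal.toReal_mono ?_ (le_min (hn x hx) ha.le)
        exact ((min_le_right _ _).trans_lt ENNReal.one_lt_top).ne
      · rw [Measure.restrict_apply_univ, hausdorff, Measure.smul_apply, smul_eq_mul]
        refine ENNReal.mul_lt_top ENNReal.ofReal_lt_top ((measure_mono hfront).trans_lt ?_)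
        refine lt_of_le_of_lt ?_ htfin
        simpa using hχ t
    refine (hg.2 _ hsep).trans ?_
    rw [hausdorff, Measure.restrict_smul, lintegral_smul_measure, smul_eq_mul]
    exact mul_le_mul_right ((lintegral_mono_set hfront).trans (hψ t)) _
  calc a = ∫⁻ _ in Ioo 0 a.toReal, 1 := by
        rw [setLIntegral_const, Real.volume_Ioo, sub_zero, one_mul,
          ENNReal.ofReal_toReal (ha.trans_le le_top).ne]
    _ ≤ ∫⁻ t in Ioo 0 a.toReal, C * ψ t :=
        lintegral_mono_ae ((ae_restrict_iff' measurableSet_Ioo).2 hkey)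
    _ ≤ ∫⁻ t, C * ψ t := setLIntegral_le_lintegral _ _
    _ = C * ∫⁻ t, ψ t := lintegral_const_mul _ hψm
    _ ≤ C * ∫⁻ x, g x * ρ x ∂μH[N] := by
        refine mul_le_mul_right (hψint.trans (lintegral_mono fun x ↦ ?_)) _
        exact mul_le_mul_right (min_le_left _ _) _

/-- Admissible functions can be approximated from above by lower semicontinuous ones that are
bounded away from zero. -/
theorem exists_lowerSemicontinuous_ge_lintegral_rpow_le {μ : Measure X} [IsFiniteMeasure μ]
    {p : ℝ} (hp : 0 < p) {ρ : X → ℝ≥0∞} (hρ : Measurable ρ) {τ : ℝ≥0∞} (hτ : τ ≠ 0) :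
    ∃ ρ' : X → ℝ≥0∞, LowerSemicontinuous ρ' ∧ (∀ x, ρ x ≤ ρ' x) ∧
      (∃ c : ℝ≥0∞, c ≠ 0 ∧ c ≤ 1 ∧ ∀ x, c ≤ ρ' x) ∧
      ∫⁻ x, ρ' x ^ p ∂μ ≤ ∫⁻ x, ρ x ^ p ∂μ + τ := by
  have hτ2 : τ / 2 ≠ 0 := (ENNReal.half_pos hτ).ne'
  -- Raising `ρ ^ p` to at least `e` costs at most `τ / 2`; the semicontinuous majorant costs the
  -- other half.
  set e : ℝ≥0∞ := min 1 (τ / 2 / μ univ) with he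
  have he0 : e ≠ 0 :=
    (lt_min one_pos (ENNReal.div_pos hτ2 (measure_ne_top μ univ))).ne'
  obtain ⟨h, hle, hlsc, hint⟩ := exists_le_lowerSemicontinuous_lintegral_ge μ
    (fun x ↦ max (ρ x ^ p) e) ((hρ.pow_const p).max measurable_const) hτ2
  have hmono : Monotone fun y : ℝ≥0∞ ↦ y ^ (1 / p) :=
    ENNReal.monotone_rpow_of_nonneg (by positivity)
  refine ⟨fun x ↦ h x ^ (1 / p),
    (ENNReal.continuous_rpow_const (y := 1 / p)).comp_lowerSemicontinuous hlsc hmono,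
    fun x ↦ ?_, ⟨e ^ (1 / p), ?_, ?_, fun x ↦ ?_⟩, ?_⟩
  · rw [one_div, ENNReal.le_rpow_inv_iff hp]
    exact (le_max_left _ _).trans (hle x)
  · exact (ENNReal.rpow_pos_of_nonneg he0.bot_lt (by positivity)).ne'
  · exact ENNReal.rpow_le_one (min_le_left _ _) (by positivity)
  · exact hmono ((le_max_right _ _).trans (hle x))
  · simp only [one_div, ENNReal.rpow_inv_rpow hp.ne']
    calc ∫⁻ x, h x ∂μ ≤ ∫⁻ x, max (ρ x ^ p) e ∂μ + τ / 2 := hint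
      _ ≤ ∫⁻ x, (ρ x ^ p + e) ∂μ + τ / 2 := by
          gcongr
          exact max_le_add_of_nonneg zero_le zero_le
      _ = ∫⁻ x, ρ x ^ p ∂μ + e * μ univ + τ / 2 := by
          rw [lintegral_add_right _ measurable_const, lintegral_const]
      _ ≤ ∫⁻ x, ρ x ^ p ∂μ + τ / 2 + τ / 2 := by
          gcongr
          exact ENNReal.mul_le_of_le_div (min_le_right _ _)
      _ = _ := by rw [add_assoc, ENNReal.add_halves]

theorem ballVol_div_le_lintegral_mul_lintegral (hN : 1 ≤ N)
    (hfin : hausdorff N (univ : Set X) < ∞) {p q : ℝ} (hpq : p.HolderConjugate q)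
    (hE : IsClosed E) (hF : IsClosed F) {ρ g : X → ℝ≥0∞}
    (hρ : ρ ∈ AdmCurves (connectingCurves E F)) (hg : g ∈ AdmMeasures (separatingMeasures N E F))
    (hgtop : ∫⁻ x, g x ^ q ∂(hausdorff N) ≠ ∞) :
    ENNReal.ofReal (ballVol N / (2 * ballVol (N - 1))) ≤
      (∫⁻ x, ρ x ^ p ∂(hausdorff N)) ^ (1 / p) * (∫⁻ x, g x ^ q ∂(hausdorff N)) ^ (1 / q) := by
  have hv := ballVol_pos (sub_nonneg.2 hN)
  have hv' := ballVol_pos (zero_le_one.trans hN)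
  have hcN : 0 < ballVol N / 2 ^ N := by positivity
  have hfinH : μH[N] (univ : Set X) ≠ ∞ := by
    intro htop
    simp [hausdorff, htop, hcN] at hfin
  have : IsFiniteMeasure (hausdorff N : Measure X) := ⟨hfin⟩
  have hbound : ∀ τ : ℝ≥0∞, τ ≠ 0 → ENNReal.ofReal (ballVol N / (2 * ballVol (N - 1))) ≤
      (∫⁻ x, ρ x ^ p ∂(hausdorff N) + τ) ^ (1 / p) *
        (∫⁻ x, g x ^ q ∂(hausdorff N)) ^ (1 / q) := by
    intro τ hτ
    obtain ⟨ρ', hlsc, hle, ⟨c, hc0, hc1, hc⟩, hint⟩ :=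
      exists_lowerSemicontinuous_ge_lintegral_rpow_le (μ := hausdorff N) hpq.pos hρ.1 hτ
    have hone := one_le_lintegral_mul_of_lowerSemicontinuous hN hfinH hE hF hlsc hc0 hc1 hc
      (mem_admCurves_of_le hρ hlsc.measurable hle) hg
    calc ENNReal.ofReal (ballVol N / (2 * ballVol (N - 1)))
        ≤ ENNReal.ofReal (ballVol N / (2 * ballVol (N - 1))) *
          (ENNReal.ofReal (ballVol (N - 1) / 2 ^ (N - 1)) * ∫⁻ x, g x * ρ' x ∂μH[N]) :=
          le_mul_of_one_le_right zero_le hone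
      _ = ∫⁻ x, g x * ρ' x ∂(hausdorff N) := by
          rw [← mul_assoc, ← ENNReal.ofReal_mul (by positivity), hausdorff,
            lintegral_smul_measure, smul_eq_mul]
          congr 2
          -- The constant times the normalization `v_{N-1} / 2^(N-1)` is `v_N / 2^N`, the
          -- normalization of `hausdorff N`.
          rw [Real.rpow_sub_one two_ne_zero]
          field_simp
      _ = ∫⁻ x, (ρ' * g) x ∂(hausdorff N) := lintegral_congr fun x ↦ mul_comm _ _
      _ ≤ _ := ENNReal.lintegral_mul_le_Lp_mul_Lq _ hpq hlsc.measurable.aemeasurable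
          hg.1.aemeasurable
      _ ≤ _ := mul_le_mul_left (ENNReal.rpow_le_rpow hint (by have := hpq.pos; positivity)) _
  rcases eq_or_ne (∫⁻ x, ρ x ^ p ∂(hausdorff N)) ∞ with htop | htop
  · simpa [htop] using hbound 1 one_ne_zero
  · refine ENNReal.le_rpow_mul_of_forall_gt htop
      (ENNReal.rpow_ne_top_of_nonneg (by have := hpq.symm.pos; positivity) hgtop) fun x hx ↦ ?_
    simpa [add_tsub_cancel_of_le hx.le] using hbound (x - _) (tsub_pos_of_lt hx).ne'

end duality

theorem theorem1p1 {X : Type*} [MetricSpace X] [CompactSpace X] [MeasurableSpace X] [BorelSpace X]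
    (N : ℝ) (hN : 1 ≤ N)
    (hfin : MetricModulus.hausdorff N (Set.univ : Set X) < ∞)
    (p q : ℝ) (hp : 1 < p) (hq : 1 < q) (hpq : p⁻¹ + q⁻¹ = 1)
    (E F : Set X) (hE : IsCompact E) (hE' : IsConnected E)
    (hF : IsCompact F) (hF' : IsConnected F) (hEF : Disjoint E F) :
    (0 < MetricModulus.modCurves N p (MetricModulus.connectingCurves E F) →
      ENNReal.ofReal (MetricModulus.ballVol N / (2 * MetricModulus.ballVol (N - 1))) ≤
        MetricModulus.modCurves N p (MetricModulus.connectingCurves E F) ^ (1 / p) *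
          MetricModulus.modMeasures N q (MetricModulus.separatingMeasures N E F) ^ (1 / q)) ∧
    (MetricModulus.modCurves N p (MetricModulus.connectingCurves E F) = 0 →
      MetricModulus.modMeasures N q (MetricModulus.separatingMeasures N E F) = ∞) := by
  have hpq' : p.HolderConjugate q := Real.holderConjugate_iff.2 ⟨hp, hpq⟩
  have hcore : ∀ g ∈ AdmMeasures (separatingMeasures N E F),
      ∫⁻ x, g x ^ q ∂(hausdorff N) ≠ ∞ →
        ENNReal.ofReal (ballVol N / (2 * ballVol (N - 1))) ≤
          modCurves N p (connectingCurves E F) ^ (1 / p) *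
            (∫⁻ x, g x ^ q ∂(hausdorff N)) ^ (1 / q) := by
    intro g hg hgtop
    refine ENNReal.le_rpow_mul_of_forall_gt
      (modCurves_connectingCurves_ne_top hfin hpq'.nonneg hE hF.isClosed hEF)
      (ENNReal.rpow_ne_top_of_nonneg (by positivity) hgtop) fun x hx ↦ ?_
    simp only [modCurves, iInf_lt_iff] at hx
    obtain ⟨ρ, hρ, hρx⟩ := hx
    refine (ballVol_div_le_lintegral_mul_lintegral hN hfin hpq' hE.isClosed hF.isClosed hρ hg
      hgtop).trans (mul_le_mul_left (ENNReal.rpow_le_rpow hρx.le (by positivity)) _)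
  refine ⟨fun hpos ↦ ?_, fun hzero ↦ ?_⟩
  · have hMp : modCurves N p (connectingCurves E F) ^ (1 / p) ≠ 0 :=
      (ENNReal.rpow_pos_of_nonneg hpos (by positivity)).ne'
    rcases eq_or_ne (modMeasures N q (separatingMeasures N E F)) ∞ with htop | htop
    · rw [htop, ENNReal.top_rpow_of_pos (by positivity), ENNReal.mul_top hMp]
      exact le_top
    · rw [mul_comm (_ ^ (1 / p))]
      refine ENNReal.le_rpow_mul_of_forall_gt htop (ENNReal.rpow_ne_top_of_nonneg (by positivity)
        (modCurves_connectingCurves_ne_top hfin hpq'.nonneg hE hF.isClosed hEF)) fun x hx ↦ ?_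
      simp only [modMeasures, iInf_lt_iff] at hx
      obtain ⟨g, hg, hgx⟩ := hx
      rw [mul_comm (x ^ _)]
      exact (hcore g hg (hgx.trans_le le_top).ne).trans
        (mul_le_mul_right (ENNReal.rpow_le_rpow hgx.le (by positivity)) _)
  -- A finite modulus would give an admissible `g` of finite energy, and `hcore` would bound a
  -- positive constant by `0 ^ (1 / p)` times a finite number.
  · by_contra htop
    obtain ⟨g, hg, hgx⟩ : ∃ g, ∃ _ : g ∈ AdmMeasures (separatingMeasures N E F),
        ∫⁻ x, g x ^ q ∂(hausdorff N) < ∞ := by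
      have := lt_top_iff_ne_top.2 htop
      simpa only [modMeasures, iInf_lt_iff] using this
    have h := hcore g hg hgx.ne
    rw [hzero, ENNReal.zero_rpow_of_pos (by positivity), zero_mul, nonpos_iff_eq_zero,
      ENNReal.ofReal_eq_zero] at h
    have h1 := ballVol_pos (sub_nonneg.2 hN)
    have h2 := ballVol_pos (zero_le_one.trans hN)
    exact absurd h (not_le.2 (by positivity))
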